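/- Let $K$ be a field extension of $\mathbb R$ (for example $K=\mathbb R$ or $\mathbb C$). A Volterra evolution algebra over $K$ is a (not necessarily associative) $K$-algebra $\mathcal E$ with a basis $e_1,\dots,e_n$ (a natural basis) such that $e_ie_j=0$ for $i\ne j$ and $e_i^2=\sum_{k}a_{ik}e_k$, where the structure matrix $A=(a_{ik})$ is skew-symmetric. Two algebras are isomorphic if there is a bijective linear map between them that preserves products. For a real skew-symmetric $m\times m$ matrix $A=(a_{ki})$ with $|a_{ki}|\le 1$, the corresponding Volterra quadratic stochastic operator is the map $$V:S^{m-1}\to S^{m-1},\qquad (Vx)_k=x_k\Bigl(1+\sum_{i=1}^m a_{ki}x_i\Bigr),\quad k=1,\dots,m,$$ of the simplex $S^{m-1}=\{x\in\mathbb R^m: x_i\ge 0,\ \sum_i x_i=1\}$. It is called ergodic if $\lim_{n\to\infty}\frac1n\sum_{k=0}^{n-1}V^kx$ exists for every $x\in S^{m-1}$, and non-ergodic otherwise. **Theorem.** Let $a_i,b_i,c_i$ ($i=1,2$) be nonzero real numbers in $[-1,1]$, and let $\mathcal E_1,\mathcal E_2$ be 3-dimensional Volterra evolution algebras over $K$ whose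 structure matrices, with respect to some natural bases, are $$A_{\mathcal E_i}=\begin{pmatrix}0&a_i&-b_i\\-a_i&0&c_i\\b_i&-c_i&0\end{pmatrix},\qquad i=1,2.$$ If $\mathcal E_1$ and $\mathcal E_2$ are isomorphic, then the Volterra quadratic stochastic operators on $S^2$ corresponding to $A_{\mathcal E_1}$ and $A_{\mathcal E_2}$ are either both ergodic or both non-ergodic. -/

import Mathlib

open Filter Topology

/-- `b` is a natural basis of the algebra `E`, with structure matrix `A`:
`e_i e_j = 0` for `i ≠ j`, and `e_i e_i = ∑ k, a_{ik} e_k`. -/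
structure IsNaturalBasis {ι K E : Type*} [Fintype ι] [Field K] [NonUnitalNonAssocRing E]
    [Module K E] (b : Module.Basis ι K E) (A : Matrix ι ι K) : Prop where
  mul_of_ne : ∀ i j, i ≠ j → b i * b j = 0
  mul_self : ∀ i, b i * b i = ∑ k, A i k • b k

/-- `E` is a Volterra evolution algebra with respect to the natural basis `b`, with
skew-symmetric structure matrix `A`. -/
structure IsVolterraEvolutionAlgebra {ι K E : Type*} [Fintype ι] [Field K]
    [NonUnitalNonAssocRing E] [Module K E] (b : Module.Basis ι K E) (A : Matrix ι ι K) :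
    Prop where
  isNaturalBasis : IsNaturalBasis b A
  skew : A.transpose = -A

/-- Isomorphism of algebras: a bijective linear map that preserves products. -/
def AlgIsomorphic (K E₁ E₂ : Type*) [Field K] [NonUnitalNonAssocRing E₁] [Module K E₁]
    [NonUnitalNonAssocRing E₂] [Module K E₂] : Prop :=
  ∃ ψ : E₁ →ₙₐ[K] E₂, Function.Bijective ψ

/-- The coefficients `p i j k` of a quadratic stochastic operator. -/
structure IsQSOCoeff {ι : Type*} [Fintype ι] (p : ι → ι → ι → ℝ) : Prop where
  nonneg : ∀ i j k, 0 ≤ p i j k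
  sum_eq_one : ∀ i j, ∑ k, p i j k = 1
  symm : ∀ i j k, p i j k = p j i k

/-- `V` is, on the simplex, the quadratic stochastic operator with coefficients `p`, and
`p i j k = 0` whenever `k ∉ {i, j}`. -/
def IsVolterraQSO {ι : Type*} [Fintype ι] (V : (ι → ℝ) → (ι → ℝ)) : Prop :=
  ∃ p : ι → ι → ι → ℝ, IsQSOCoeff p ∧ (∀ i j k, k ≠ i → k ≠ j → p i j k = 0) ∧
    ∀ x ∈ stdSimplex ℝ ι, ∀ k, V x k = ∑ i, ∑ j, p i j k * x i * x j

/-- The operator `(V x)_k = x_k (1 + ∑ i, a_{ki} x_i)`. It is a Volterra quadratic stochastic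
operator when `A` is skew-symmetric with entries in `[-1, 1]`. -/
def volterraOperator {ι : Type*} [Fintype ι] (A : Matrix ι ι ℝ) (x : ι → ℝ) : ι → ℝ :=
  fun k => x k * (1 + ∑ i, A k i * x i)

/-- The ergodic theorem holds for `V`: for every `x` in the simplex the Cesàro means
`(1/n) ∑_{k<n} V^k x` converge. -/
def IsErgodicOperator {ι : Type*} [Fintype ι] (V : (ι → ℝ) → (ι → ℝ)) : Prop :=
  ∀ x ∈ stdSimplex ℝ ι, ∃ l : ι → ℝ,
    Tendsto (fun n : ℕ => (1 / (n : ℝ)) • ∑ k ∈ Finset.range n, V^[k] x) atTop (𝓝 l)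

/-- The `3 × 3` skew-symmetric matrix with parameters `a`, `b`, `c`. -/
def skewMatrix (a b c : ℝ) : Matrix (Fin 3) (Fin 3) ℝ :=
  !![0, a, -b; -a, 0, c; b, -c, 0]

theorem isVolterraQSO_volterraOperator {ι : Type*} [Fintype ι] (A : Matrix ι ι ℝ)
    (hA : A.transpose = -A) (hb : ∀ i j, |A i j| ≤ 1) :
    IsVolterraQSO (volterraOperator A) := by
  classical
  have hs : ∀ i j, A j i = -A i j := fun i j => congrFun (congrFun hA i) j
  refine ⟨fun i j k => (if k = i then (1 + A i j) / 2 else 0) +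
    (if k = j then (1 + A j i) / 2 else 0), ⟨?_, ?_, ?_⟩, ?_, ?_⟩
  · intro i j k
    have h1 := abs_le.mp (hb i j)
    have h2 := abs_le.mp (hb j i)
    apply add_nonneg <;> split_ifs <;> linarith
  · intro i j
    rw [Finset.sum_add_distrib]
    simp [hs i j]
    ring
  · intro i j k
    exact add_comm _ _
  · intro i j k h1 h2
    simp [h1, h2]
  · intro x hx k
    have hx1 : ∑ i, x i = 1 := hx.2
    have e : ∀ i j, ((if k = i then (1 + A i j) / 2 else 0) +
        (if k = j then (1 + A j i) / 2 else 0)) * x i * x j =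
        (if k = i then (1 + A i j) / 2 * x i * x j else 0) +
        (if k = j then (1 + A j i) / 2 * x i * x j else 0) := by
      intro i j
      split_ifs <;> ring
    simp only [e, Finset.sum_add_distrib]
    have h1 : ∑ i, ∑ j, (if k = i then (1 + A i j) / 2 * x i * x j else 0) =
        ∑ j, (1 + A k j) / 2 * x k * x j := by
      rw [Finset.sum_comm]
      simp
    have h2 : ∑ i, ∑ j, (if k = j then (1 + A j i) / 2 * x i * x j else 0) =
        ∑ j, (1 + A k j) / 2 * x k * x j := by
      simp only [Finset.sum_ite_eq, Finset.mem_univ, if_true]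
      exact Finset.sum_congr rfl fun i _ => by ring
    have h3 : volterraOperator A x k = ∑ i, (x k * x i + x k * (A k i * x i)) := by
      rw [Finset.sum_add_distrib, ← Finset.mul_sum, ← Finset.mul_sum, hx1, volterraOperator]
      ring
    rw [h1, h2, h3, ← Finset.sum_add_distrib]
    exact Finset.sum_congr rfl fun i _ => by ring

theorem isVolterraQSO_skewMatrix (a b c : ℝ) (h : |a| ≤ 1 ∧ |b| ≤ 1 ∧ |c| ≤ 1) :
    IsVolterraQSO (volterraOperator (skewMatrix a b c)) := by
  obtain ⟨ha, hb, hc⟩ := h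
  apply isVolterraQSO_volterraOperator
  · ext i j
    fin_cases i <;> fin_cases j <;> simp [skewMatrix]
  · intro i j
    fin_cases i <;> fin_cases j <;> simp [skewMatrix, ha, hb, hc]

/-! Both sides are governed by one sign condition, `HasMixedRows`: for nonzero `a`, `b`, `c` it says
that they share a sign, so that the three species beat one another cyclically.

If the signs differ, one species beats the other two. Its coordinate is monotone, and every orbit
converges (`exists_tendsto_of_dominant`). In the cyclic case a weighted sum of logarithms decreases
linearly along suitable interior orbits, so some coordinate is always exponentially small
(`exists_le_pow`). Such an orbit passes from vertex to vertex and stays near one for a time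
comparable to all the time elapsed before, so its Cesàro means cannot converge (`not_cesaro`).

For an isomorphism, images of distinct basis vectors multiply to zero, which puts the coordinate
products of two rows of its matrix in the one-dimensional left kernel of the structure matrix. This
forces a monomial matrix, and skew-symmetry together with uniqueness of real cube roots shows that
the structure matrices agree up to a permutation and a real scaling of rows
(`exists_perm_row_scaling`). Such a scaling preserves mixed rows. -/

/-! ### Two analytic estimates -/

theorem log_one_add_le_sub_sq {u : ℝ} (h₁ : -1 < u) (h₂ : u ≤ 1) :
    Real.log (1 + u) ≤ u - u ^ 2 / 8 := by
  have hpos : 0 < 1 + u := by linarith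
  -- Applying `log s ≤ s - 1` to the square root leaves the gain `u - 2 * (s - 1) = (s - 1) ^ 2`,
  -- which is comparable to `u ^ 2`.
  set s := Real.sqrt (1 + u) with hs
  have hs0 : 0 < s := Real.sqrt_pos.mpr hpos
  have hss : s ^ 2 = 1 + u := Real.sq_sqrt hpos.le
  have hlog : Real.log (1 + u) = 2 * Real.log s := by
    rw [← hss, Real.log_pow]; norm_num
  have hle := Real.log_le_sub_one_of_pos hs0
  have hu : u = (s - 1) * (s + 1) := by linarith [hss, sq_nonneg s, (by ring : (s-1)*(s+1) = s^2 - 1)]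
  have hs32 : s ≤ 3 / 2 := by nlinarith
  have h8 : (s + 1) ^ 2 ≤ 8 := by nlinarith
  have h9 : u ^ 2 ≤ 8 * (s - 1) ^ 2 := by
    rw [hu, mul_pow, mul_comm]
    exact mul_le_mul_of_nonneg_right h8 (sq_nonneg _)
  nlinarith

/-- If a sequence has Cesàro limit `q` and its sums over arbitrarily long windows, of length
comparable to their starting time, are at least the length up to a constant, then `1 ≤ q`. -/
theorem one_le_of_tendsto_cesaro {s : ℕ → ℝ} {q D : ℝ} {L : ℕ}
    (h : Tendsto (fun n : ℕ => (1 / (n : ℝ)) * ∑ k ∈ Finset.range n, s k) atTop (𝓝 q))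
    (hw : ∀ N : ℕ, ∃ m K : ℕ, N ≤ K ∧ K ≤ m ∧ m ≤ L * K ∧
      (K : ℝ) - D ≤ ∑ k ∈ Finset.range K, s (m + k)) : 1 ≤ q := by
  by_contra hq
  push Not at hq
  -- The window sum is a difference of two partial sums, hence within `η * (2 * m + K) ≤ 3 * η * L *
  -- K` of `q * K`; this choice keeps the error below `(1 - q) / 2 * K`.
  set η : ℝ := (1 - q) / (6 * (L + 1)) with hη
  have hη0 : 0 < η := by
    apply div_pos <;> [linarith; positivity]
  obtain ⟨N, hN⟩ := (Metric.tendsto_atTop.mp h) η hη0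
  have hb : ∀ n : ℕ, N ≤ n → 0 < n →
      |(∑ k ∈ Finset.range n, s k) - q * n| ≤ η * n := by
    intro n hn h0
    have h0' : (0 : ℝ) < n := by exact_mod_cast h0
    have := (hN n hn).le
    rw [Real.dist_eq] at this
    have e : (∑ k ∈ Finset.range n, s k) - q * n =
        ((1 / (n : ℝ)) * ∑ k ∈ Finset.range n, s k - q) * n := by
      field_simp
    rw [e, abs_mul, abs_of_pos h0']
    exact mul_le_mul_of_nonneg_right this h0'.le
  obtain ⟨M, hM⟩ := exists_nat_gt (2 * D / (1 - q))
  obtain ⟨m, K, hK, hKm, hmL, hsum⟩ := hw (N + M + 1)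
  have h1 := abs_le.mp (hb m (by omega) (by omega))
  have h2 := abs_le.mp (hb (m + K) (by omega) (by omega))
  rw [Finset.sum_range_add] at h2
  push_cast at h2
  have hKm' : (K : ℝ) ≤ m := by exact_mod_cast hKm
  have hmL' : (m : ℝ) ≤ L * K := by exact_mod_cast hmL
  have hMK : (M : ℝ) < K := by exact_mod_cast (by omega : M < K)
  have hK0 : (0 : ℝ) ≤ K := by positivity
  have hD : 2 * D < (1 - q) * K := by
    rw [div_lt_iff₀ (by linarith)] at hM
    nlinarith
  have h3 : (K : ℝ) - D ≤ q * K + 3 * η * m := by nlinarith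
  have h4 : 3 * η * (L * K) ≤ (1 - q) / 2 * K := by
    have : η * (6 * (L + 1)) = 1 - q := by rw [hη]; field_simp
    nlinarith [mul_nonneg hη0.le hK0]
  have h5 : 3 * η * m ≤ 3 * η * (L * K) := by gcongr
  nlinarith

/-! ### Cyclic orbits: symmetry and one-step bounds -/

/-- Interior orbits of the Volterra operators with cyclic interaction of the three species. -/
structure IsCyclicOrbit (a b c : ℝ) (x y z : ℕ → ℝ) : Prop where
  a_pos : 0 < a
  b_pos : 0 < b
  c_pos : 0 < c
  a_le : a ≤ 1
  b_le : b ≤ 1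
  c_le : c ≤ 1
  x_pos : ∀ n, 0 < x n
  y_pos : ∀ n, 0 < y n
  z_pos : ∀ n, 0 < z n
  sum_eq : ∀ n, x n + y n + z n = 1
  x_succ : ∀ n, x (n + 1) = x n * (1 + a * y n - b * z n)
  y_succ : ∀ n, y (n + 1) = y n * (1 + c * z n - a * x n)
  z_succ : ∀ n, z (n + 1) = z n * (1 + b * x n - c * y n)

namespace IsCyclicOrbit

variable {a b c : ℝ} {x y z : ℕ → ℝ}

/-- Cyclic symmetry: an estimate proved for one coordinate, edge or vertex transfers to the other
two. -/
theorem rotate (h : IsCyclicOrbit a b c x y z) : IsCyclicOrbit c a b y z x where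
  a_pos := h.c_pos
  b_pos := h.a_pos
  c_pos := h.b_pos
  a_le := h.c_le
  b_le := h.a_le
  c_le := h.b_le
  x_pos := h.y_pos
  y_pos := h.z_pos
  z_pos := h.x_pos
  sum_eq n := by linarith [h.sum_eq n]
  x_succ := h.y_succ
  y_succ := h.z_succ
  z_succ := h.x_succ

theorem x_lt_one (h : IsCyclicOrbit a b c x y z) (n : ℕ) : x n < 1 := by
  linarith [h.sum_eq n, h.y_pos n, h.z_pos n]

theorem z_lt_one (h : IsCyclicOrbit a b c x y z) (n : ℕ) : z n < 1 :=
  h.rotate.rotate.x_lt_one n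

theorem y_lt_one (h : IsCyclicOrbit a b c x y z) (n : ℕ) : y n < 1 :=
  h.rotate.x_lt_one n

theorem growth_bounds (h : IsCyclicOrbit a b c x y z) (n : ℕ) :
    -1 < a * y n - b * z n ∧ a * y n - b * z n ≤ 1 := by
  have h1 := h.y_pos n
  have h2 := h.z_pos n
  have h3 := h.z_lt_one n
  have h4 := h.y_lt_one n
  constructor <;> nlinarith [h.a_pos, h.a_le, h.b_pos, h.b_le, mul_pos h.a_pos h1,
    mul_pos h.b_pos h2]

theorem x_succ_le (h : IsCyclicOrbit a b c x y z) (n : ℕ) : x (n + 1) ≤ 2 * x n := by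
  rw [h.x_succ]
  nlinarith [h.x_pos n, (h.growth_bounds n).2]

theorem x_add_le (h : IsCyclicOrbit a b c x y z) (n k : ℕ) : x (n + k) ≤ 2 ^ k * x n := by
  induction k with
  | zero => simp
  | succ k ih =>
    have := h.x_succ_le (n + k)
    rw [← add_assoc, pow_succ]
    linarith

theorem log_x_succ_le (h : IsCyclicOrbit a b c x y z) (n : ℕ) :
    Real.log (x (n + 1)) ≤
      Real.log (x n) + (a * y n - b * z n) - (a * y n - b * z n) ^ 2 / 8 := by
  obtain ⟨h1, h2⟩ := h.growth_bounds n
  rw [h.x_succ, show 1 + a * y n - b * z n = 1 + (a * y n - b * z n) by ring,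
    Real.log_mul (h.x_pos n).ne' (by linarith)]
  linarith [log_one_add_le_sub_sq h1 h2]

/-! ### Exponential approach to the boundary -/

/-- If one coordinate is small, some growth rate is bounded away from zero. -/
theorem sum_sq_ge (h : IsCyclicOrbit a b c x y z) {μ : ℝ} (hμ : 0 < μ) (hc : μ ≤ c) {n : ℕ}
    (hx : x n ≤ μ / 8) :
    (μ / 8) ^ 2 ≤ (a * y n - b * z n) ^ 2 + (c * z n - a * x n) ^ 2 +
      (b * x n - c * y n) ^ 2 := by
  by_contra hlt
  push Not at hlt
  have h2 : |c * z n - a * x n| < μ / 8 := abs_lt_of_sq_lt_sq (by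
    nlinarith [sq_nonneg (a * y n - b * z n), sq_nonneg (b * x n - c * y n)]) (by positivity)
  have h3 : |b * x n - c * y n| < μ / 8 := abs_lt_of_sq_lt_sq (by
    nlinarith [sq_nonneg (a * y n - b * z n), sq_nonneg (c * z n - a * x n)]) (by positivity)
  rw [abs_lt] at h2 h3
  have h4 : a * x n ≤ x n := by nlinarith [h.a_le, h.x_pos n]
  have h5 : b * x n ≤ x n := by nlinarith [h.b_le, h.x_pos n]
  -- Small rates and small `x` make both `c * y` and `c * z` small, although `y + z` is close to
  -- one.
  have h6 : c * (1 - x n) ≤ μ / 2 := by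
    have : c * (1 - x n) = c * y n + c * z n := by rw [← h.sum_eq n]; ring
    linarith
  nlinarith [h.c_le]

/-- Orbits that start near the boundary approach it exponentially fast. -/
theorem exists_le_pow (h : IsCyclicOrbit a b c x y z) {μ : ℝ} (hμ : 0 < μ)
    (ha : μ ≤ a) (hb : μ ≤ b) (hc : μ ≤ c) (h0 : c * Real.log (x 0) ≤ 3 * Real.log (μ / 8)) :
    ∃ ρ : ℝ, 0 < ρ ∧ ρ < 1 ∧ ∀ n, x n ≤ ρ ^ n ∨ y n ≤ ρ ^ n ∨ z n ≤ ρ ^ n := by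
  -- With these weights the linear terms of the three growth rates cancel, so only the negative
  -- quadratic terms of `log_x_succ_le` remain.
  set W : ℕ → ℝ := fun n => c * Real.log (x n) + b * Real.log (y n) + a * Real.log (z n) with hW
  have hμ1 : μ ≤ 1 := ha.trans h.a_le
  have hlogμ : Real.log (μ / 8) < 0 := Real.log_neg (by positivity) (by linarith)
  have hall : ∀ (n : ℕ) (t : ℝ), 0 < t → t < 1 → t < x n → t < y n → t < z n →
      3 * Real.log t < W n := by
    intro n t ht0 ht1 hx hy hz
    have e := Real.log_neg ht0 ht1
    have ex := Real.log_lt_log ht0 hx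
    have ey := Real.log_lt_log ht0 hy
    have ez := Real.log_lt_log ht0 hz
    simp only [hW]
    nlinarith [mul_lt_mul_of_pos_left ex h.c_pos, mul_lt_mul_of_pos_left ey h.b_pos,
      mul_lt_mul_of_pos_left ez h.a_pos, h.a_le, h.b_le, h.c_le]
  have hW0 : W 0 ≤ 3 * Real.log (μ / 8) := by
    have ey := Real.log_neg (h.y_pos 0) (h.y_lt_one 0)
    have ez := Real.log_neg (h.z_pos 0) (h.z_lt_one 0)
    simp only [hW]
    nlinarith [h.a_pos, h.b_pos]
  -- Weights at least `μ`, squared rates summing to at least `(μ / 8) ^ 2`, and the `1 / 8` of the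
  -- logarithm bound.
  set δ : ℝ := μ * (μ / 8) ^ 2 / 8 with hδ
  have hδ0 : 0 < δ := by positivity
  have hstep : ∀ n, W n ≤ 3 * Real.log (μ / 8) → W (n + 1) ≤ W n - δ := by
    intro n hn
    have hsq : (μ / 8) ^ 2 ≤ (a * y n - b * z n) ^ 2 + (c * z n - a * x n) ^ 2 +
        (b * x n - c * y n) ^ 2 := by
      by_cases hx : x n ≤ μ / 8
      · exact h.sum_sq_ge hμ hc hx
      by_cases hy : y n ≤ μ / 8
      · linarith [h.rotate.sum_sq_ge hμ hb hy]
      by_cases hz : z n ≤ μ / 8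
      · linarith [h.rotate.rotate.sum_sq_ge hμ ha hz]
      push Not at hx hy hz
      linarith [hall n (μ / 8) (by positivity) (by linarith) hx hy hz]
    have e1 := mul_le_mul_of_nonneg_left (h.log_x_succ_le n) h.c_pos.le
    have e2 := mul_le_mul_of_nonneg_left (h.rotate.log_x_succ_le n) h.b_pos.le
    have e3 := mul_le_mul_of_nonneg_left (h.rotate.rotate.log_x_succ_le n) h.a_pos.le
    have f1 := mul_le_mul_of_nonneg_right hc (sq_nonneg (a * y n - b * z n))
    have f2 := mul_le_mul_of_nonneg_right hb (sq_nonneg (c * z n - a * x n))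
    have f3 := mul_le_mul_of_nonneg_right ha (sq_nonneg (b * x n - c * y n))
    have f4 := mul_le_mul_of_nonneg_left hsq hμ.le
    simp only [hW, hδ]
    linarith
  have hlin : ∀ n : ℕ, W n ≤ 3 * Real.log (μ / 8) - δ * n := by
    intro n
    induction n with
    | zero => simpa using hW0
    | succ n ih =>
      have : 0 ≤ δ * n := by positivity
      have := hstep n (by linarith)
      push_cast
      linarith
  refine ⟨Real.exp (-δ / 3), Real.exp_pos _, Real.exp_lt_one_iff.mpr (by linarith), fun n => ?_⟩
  by_contra hcon
  push Not at hcon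
  rcases Nat.eq_zero_or_pos n with rfl | hn
  · linarith [hcon.1, h.x_lt_one 0, pow_zero (Real.exp (-δ / 3))]
  have := hall n _ (by positivity) (pow_lt_one₀ (Real.exp_pos _).le
    (Real.exp_lt_one_iff.mpr (by linarith)) hn.ne') hcon.1 hcon.2.1 hcon.2.2
  rw [Real.log_pow, Real.log_exp] at this
  linarith [hlin n]

/-! ### Travel between vertices and divergence of the Cesàro means -/

/-- Near the vertex `z = 1` the orbit leaves along the edge `x = 0`. -/
theorem exists_escape (h : IsCyclicOrbit a b c x y z) {ε : ℝ}
    (hb : 4 * ε ≤ b) (hc : 4 * ε ≤ c) {n : ℕ} (hx : x n < ε) (hy : y n < ε) :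
    ∃ m, n ≤ m ∧ x m < ε ∧ ε ≤ y m ∧ ε ≤ z m := by
  by_contra hno
  push Not at hno
  have hε1 : 4 * ε ≤ 1 := hb.trans h.b_le
  -- Without an escape `y` would grow geometrically while staying below `ε`. When `y` first reaches
  -- `ε` it is below `2 * ε`, so `z` is still at least `ε`.
  have key : ∀ k : ℕ, x (n + k) < ε ∧ y (n + k) < ε ∧ (1 + c / 4) ^ k * y n ≤ y (n + k) := by
    intro k
    induction k with
    | zero => simpa using ⟨hx, hy⟩
    | succ k ih =>
      obtain ⟨ix, iy, ig⟩ := ih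
      have px := h.x_pos (n + k)
      have py := h.y_pos (n + k)
      have hz : 1 / 2 < z (n + k) := by linarith [h.sum_eq (n + k)]
      have ex : x (n + (k + 1)) < ε := by
        rw [← add_assoc, h.x_succ]
        have : a * y (n + k) - b * z (n + k) ≤ 0 := by nlinarith [h.a_le, h.b_pos]
        nlinarith
      have eg : (1 + c / 4) ^ (k + 1) * y n ≤ y (n + (k + 1)) := by
        rw [← add_assoc, h.y_succ, pow_succ]
        have : c / 4 ≤ c * z (n + k) - a * x (n + k) := by nlinarith [h.a_le, h.c_pos]
        nlinarith [h.c_pos]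
      have ey2 := h.rotate.x_succ_le (n + k)
      refine ⟨ex, ?_, eg⟩
      by_contra hy'
      push Not at hy'
      have := hno (n + (k + 1)) (by omega) ex hy'
      rw [← add_assoc] at *
      linarith [h.sum_eq (n + k + 1)]
  obtain ⟨k, hk⟩ := pow_unbounded_of_one_lt (1 / y n) (by linarith [h.c_pos] : 1 < 1 + c / 4)
  rw [div_lt_iff₀ (h.y_pos n)] at hk
  linarith [(key k).2.2, (key k).2.1]

/-- Behaviour of an orbit over a window in which `x` stays negligible. -/
theorem window (h : IsCyclicOrbit a b c x y z) {ε θ : ℝ} (hθc : 4 * θ ≤ c * ε)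
    {m K : ℕ} (hx : x m ≤ (1 / 4) ^ K) (hy : ε ≤ y m) (hK1 : K * (1 / 2 : ℝ) ^ K ≤ ε / 2)
    (hK2 : (1 / 2 : ℝ) ^ K ≤ θ) :
    (∀ k ≤ K, x (m + k) ≤ (1 / 2) ^ K) ∧ ∀ k ≤ K, z (m + k) ≤ (1 - θ) ^ k := by
  have hxk : ∀ k ≤ K, x (m + k) ≤ (1 / 2) ^ K := by
    intro k hk
    -- A coordinate at most doubles per step, so starting below `(1 / 4) ^ K` leaves room for `K`
    -- doublings.
    have e : (1 / 2 : ℝ) ^ K = 2 ^ K * (1 / 4) ^ K := by rw [← mul_pow]; norm_num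
    rw [e]
    refine (h.x_add_le m k).trans ?_
    have : (2 : ℝ) ^ k ≤ 2 ^ K := pow_le_pow_right₀ (by norm_num) hk
    exact mul_le_mul this hx (h.x_pos m).le (by positivity)
  have hyk : ∀ k ≤ K, ε - k * (1 / 2 : ℝ) ^ K ≤ y (m + k) := by
    intro k
    induction k with
    | zero => intro _; simpa using hy
    | succ k ih =>
      intro hk
      have i1 := ih (by omega)
      have i2 := hxk k (by omega)
      have hy1 := h.y_lt_one (m + k)
      have hy0 := h.y_pos (m + k)
      have hx0 := h.x_pos (m + k)
      have hz0 := mul_pos h.c_pos (h.z_pos (m + k))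
      have hax : a * x (m + k) ≤ x (m + k) := by nlinarith [h.a_le]
      have h3 : y (m + k) - x (m + k) ≤ y (m + k + 1) := by
        rw [h.y_succ]
        nlinarith [mul_pos hy0 hz0]
      rw [← add_assoc]
      push_cast
      linarith
  refine ⟨hxk, fun k => ?_⟩
  induction k with
  | zero => intro _; simpa using (h.z_lt_one m).le
  | succ k ih =>
    intro hk
    have i1 := ih (by omega)
    have i2 := hxk k (by omega)
    have i3 := hyk k (by omega)
    have hkK : (k : ℝ) * (1 / 2) ^ K ≤ K * (1 / 2 : ℝ) ^ K := by
      gcongr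
      omega
    have hy2 : ε / 2 ≤ y (m + k) := by linarith
    have hz0 := h.z_pos (m + k)
    have hx0 := h.x_pos (m + k)
    have hf : 1 + b * x (m + k) - c * y (m + k) ≤ 1 - θ := by
      have : b * x (m + k) ≤ x (m + k) := by nlinarith [h.b_le]
      nlinarith [h.c_pos]
    have hθ1 : 0 ≤ 1 - θ := by
      have hε1 : ε ≤ 1 := hy.trans (h.y_lt_one m).le
      nlinarith [h.c_le, h.c_pos]
    rw [← add_assoc, h.z_succ, pow_succ]
    calc z (m + k) * (1 + b * x (m + k) - c * y (m + k)) ≤ z (m + k) * (1 - θ) := by gcongr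
      _ ≤ (1 - θ) ^ k * (1 - θ) := by gcongr

/-- On leaving the vertex both `y` and `z` are at least `ε`, so the exponentially small coordinate
can only be `x`. -/
theorem exists_event (h : IsCyclicOrbit a b c x y z) {ε ρ : ℝ}
    (hb : 4 * ε ≤ b) (hc : 4 * ε ≤ c) {N : ℕ} (hN : ∀ n, N ≤ n → ρ ^ n < ε)
    (hρ : ∀ n, x n ≤ ρ ^ n ∨ y n ≤ ρ ^ n ∨ z n ≤ ρ ^ n) {n : ℕ} (hn : N ≤ n)
    (hx : x n < ε) (hy : y n < ε) : ∃ m, n ≤ m ∧ x m ≤ ρ ^ m ∧ ε ≤ y m := by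
  obtain ⟨m, hm, -, hym, hzm⟩ := h.exists_escape hb hc hx hy
  have := hN m (by omega)
  rcases hρ m with h1 | h1 | h1
  · exact ⟨m, hm, h1, hym⟩
  · linarith
  · linarith

/-- If `x` is exponentially small infinitely often while `y` is not small, then the Cesàro limit
of `y` is one, and the orbit comes infinitely often near the vertex `y = 1`. -/
theorem frequently_window (h : IsCyclicOrbit a b c x y z) {ε ρ : ℝ} (hε : 0 < ε)
    (hρ0 : 0 < ρ) (hρ1 : ρ < 1)
    (hev : ∀ N : ℕ, ∃ m, N ≤ m ∧ x m ≤ ρ ^ m ∧ ε ≤ y m) :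
    (∀ q, Tendsto (fun n : ℕ => (1 / (n : ℝ)) * ∑ k ∈ Finset.range n, y k) atTop (𝓝 q) → 1 ≤ q) ∧
      ∀ N : ℕ, ∃ m, N ≤ m ∧ z m < ε ∧ x m < ε := by
  set θ : ℝ := c * ε / 4 with hθ
  have hθ0 : 0 < θ := by have := h.c_pos; positivity
  have hε1 : ε < 1 := by
    obtain ⟨m, -, -, hm⟩ := hev 0
    exact hm.trans_lt (h.y_lt_one m)
  have hθ1 : θ < 1 := by nlinarith [h.c_le, h.c_pos]
  obtain ⟨L, hL⟩ := exists_pow_lt_of_lt_one (by norm_num : (0 : ℝ) < 1 / 4) hρ1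
  have hL0 : 0 < L := by
    rcases Nat.eq_zero_or_pos L with rfl | h0
    · norm_num at hL
    · exact h0
  have t1 : Tendsto (fun K : ℕ => (K : ℝ) * (1 / 2 : ℝ) ^ K) atTop (𝓝 0) :=
    tendsto_self_mul_const_pow_of_lt_one (by norm_num) (by norm_num)
  have t2 : Tendsto (fun K : ℕ => (1 / 2 : ℝ) ^ K) atTop (𝓝 0) :=
    tendsto_pow_atTop_nhds_zero_of_lt_one (by norm_num) (by norm_num)
  have t3 : Tendsto (fun K : ℕ => (1 - θ) ^ K) atTop (𝓝 0) :=
    tendsto_pow_atTop_nhds_zero_of_lt_one (by linarith) (by linarith)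
  have hall := ((t1.eventually_lt_const (by positivity : (0 : ℝ) < ε / 2)).and
    ((t2.eventually_lt_const hθ0).and ((t2.eventually_lt_const hε).and
      (t3.eventually_lt_const hε))))
  obtain ⟨K₀, hK₀⟩ := eventually_atTop.mp hall
  have main : ∀ N : ℕ, ∃ m K : ℕ, N ≤ K ∧ 1 ≤ K ∧ K ≤ m ∧ m ≤ (2 * L) * K ∧
      (∀ k ≤ K, x (m + k) ≤ (1 / 2) ^ K) ∧ (∀ k ≤ K, z (m + k) ≤ (1 - θ) ^ k) ∧
      (K : ℝ) * (1 / 2 : ℝ) ^ K ≤ ε / 2 ∧ (1 / 2 : ℝ) ^ K < ε ∧ (1 - θ) ^ K < ε := by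
    intro N
    -- The window length is `K = m / L`: then `ρ ^ m ≤ (1 / 4) ^ K`, and `K ≥ 1` gives `m < L * (K +
    -- 1) ≤ 2 * L * K`.
    obtain ⟨m, hm, hxm, hym⟩ := hev (L * (N + K₀ + 1))
    have hdiv : N + K₀ + 1 ≤ m / L := by
      rw [Nat.le_div_iff_mul_le hL0, mul_comm]; exact hm
    obtain ⟨e1, e2, e3, e4⟩ := hK₀ (m / L) (by omega)
    have hmod := Nat.div_add_mod m L
    have hlt := Nat.mod_lt m hL0
    have hKm : L * (m / L) ≤ m := Nat.mul_div_le m L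
    have hx4 : x m ≤ (1 / 4) ^ (m / L) := by
      calc x m ≤ ρ ^ m := hxm
        _ ≤ ρ ^ (L * (m / L)) := pow_le_pow_of_le_one hρ0.le hρ1.le hKm
        _ = (ρ ^ L) ^ (m / L) := pow_mul _ _ _
        _ ≤ (1 / 4) ^ (m / L) := by gcongr
    obtain ⟨w1, w2⟩ := h.window (by rw [hθ]; linarith) hx4 hym e1.le e2.le
    exact ⟨m, m / L, by omega, by omega, Nat.div_le_self m L, by nlinarith, w1, w2, e1.le, e3, e4⟩
  constructor
  · intro q hq
    -- Over the window `z` sums to at most `1 / θ`, and `x` to at most `K * (1 / 2) ^ K ≤ ε / 2 <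
    -- 1`.
    refine one_le_of_tendsto_cesaro (D := 1 / θ + 1) (L := 2 * L) hq fun N => ?_
    obtain ⟨m, K, hN, -, hKm, hmL, w1, w2, e1, -, -⟩ := main N
    refine ⟨m, K, hN, hKm, hmL, ?_⟩
    have hy : ∀ k ∈ Finset.range K, 1 - (1 / 2 : ℝ) ^ K - (1 - θ) ^ k ≤ y (m + k) := by
      intro k hk
      have hk' := (Finset.mem_range.mp hk).le
      linarith [w1 k hk', w2 k hk', h.sum_eq (m + k)]
    have hsum := Finset.sum_le_sum hy
    have hgeom : ∑ k ∈ Finset.range K, (1 - θ) ^ k ≤ 1 / θ := by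
      have hg := geom_sum_mul_neg (1 - θ) K
      rw [sub_sub_cancel] at hg
      rw [le_div_iff₀ hθ0, hg]
      have : 0 ≤ (1 - θ) ^ K := pow_nonneg (by linarith) K
      linarith
    simp only [Finset.sum_sub_distrib, Finset.sum_const, Finset.card_range, nsmul_eq_mul,
      mul_one] at hsum
    linarith
  · intro N
    obtain ⟨m, K, hN, -, hKm, -, w1, w2, -, e3, e4⟩ := main N
    exact ⟨m + K, by omega, (w2 K le_rfl).trans_lt e4, (w1 K le_rfl).trans_lt e3⟩

/-- Each window ends near `y = 1`, from where the orbit escapes along the edge `z = 0`; this starts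
windows of the rotated kind. Both `x` and `y` would then have Cesàro limit at least one, though `x +
y < 1`. -/
theorem not_cesaro_of_event (h : IsCyclicOrbit a b c x y z) {ε ρ p q : ℝ} (hε : 0 < ε)
    (ha : 4 * ε ≤ a) (hc : 4 * ε ≤ c)
    (hρ0 : 0 < ρ) (hρ1 : ρ < 1)
    (hρ : ∀ n, x n ≤ ρ ^ n ∨ y n ≤ ρ ^ n ∨ z n ≤ ρ ^ n)
    (hev : ∀ N : ℕ, ∃ m, N ≤ m ∧ x m ≤ ρ ^ m ∧ ε ≤ y m)
    (hp : Tendsto (fun n : ℕ => (1 / (n : ℝ)) * ∑ k ∈ Finset.range n, x k) atTop (𝓝 p))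
    (hq : Tendsto (fun n : ℕ => (1 / (n : ℝ)) * ∑ k ∈ Finset.range n, y k) atTop (𝓝 q)) :
    False := by
  obtain ⟨w1, w2⟩ := h.frequently_window hε hρ0 hρ1 hev
  have hρ' : ∀ n, z n ≤ ρ ^ n ∨ x n ≤ ρ ^ n ∨ y n ≤ ρ ^ n := fun n => by
    have := hρ n; tauto
  obtain ⟨N₀, hN₀⟩ := eventually_atTop.mp
    ((tendsto_pow_atTop_nhds_zero_of_lt_one hρ0.le hρ1).eventually_lt_const hε)
  have hev' : ∀ N : ℕ, ∃ m, N ≤ m ∧ z m ≤ ρ ^ m ∧ ε ≤ x m := by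
    intro N
    obtain ⟨n, hn, hz, hx⟩ := w2 (N + N₀)
    obtain ⟨m, hm, hm'⟩ := h.rotate.rotate.exists_event hc ha hN₀ hρ'
      (by omega : N₀ ≤ n) hz hx
    exact ⟨m, by omega, hm'⟩
  have hp1 := (h.rotate.rotate.frequently_window hε hρ0 hρ1 hev').1 p hp
  have hq1 := w1 q hq
  have hpq : p + q ≤ 1 := by
    refine le_of_tendsto (hp.add hq) (Eventually.of_forall fun n => ?_)
    rw [← mul_add, ← Finset.sum_add_distrib]
    rcases Nat.eq_zero_or_pos n with rfl | hn
    · simp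
    rw [one_div, inv_mul_le_iff₀ (by exact_mod_cast hn)]
    calc ∑ k ∈ Finset.range n, (x k + y k) ≤ ∑ k ∈ Finset.range n, (1 : ℝ) :=
          Finset.sum_le_sum fun k _ => by linarith [h.sum_eq k, h.z_pos k]
      _ = n * 1 := by simp
  linarith

/-- The Cesàro means of an orbit that starts near the boundary do not converge. -/
theorem not_cesaro (h : IsCyclicOrbit a b c x y z) {μ p q r : ℝ} (hμ : 0 < μ)
    (ha : μ ≤ a) (hb : μ ≤ b) (hc : μ ≤ c) (h0 : c * Real.log (x 0) ≤ 3 * Real.log (μ / 8))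
    (hp : Tendsto (fun n : ℕ => (1 / (n : ℝ)) * ∑ k ∈ Finset.range n, x k) atTop (𝓝 p))
    (hq : Tendsto (fun n : ℕ => (1 / (n : ℝ)) * ∑ k ∈ Finset.range n, y k) atTop (𝓝 q))
    (hr : Tendsto (fun n : ℕ => (1 / (n : ℝ)) * ∑ k ∈ Finset.range n, z k) atTop (𝓝 r)) :
    False := by
  obtain ⟨ρ, hρ0, hρ1, hρ⟩ := h.exists_le_pow hμ ha hb hc h0
  have hε : 0 < μ / 4 := by positivity
  have ha' : 4 * (μ / 4) ≤ a := by linarith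
  have hb' : 4 * (μ / 4) ≤ b := by linarith
  have hc' : 4 * (μ / 4) ≤ c := by linarith
  have hρy : ∀ n, y n ≤ ρ ^ n ∨ z n ≤ ρ ^ n ∨ x n ≤ ρ ^ n := fun n => by
    have := hρ n; tauto
  have hρz : ∀ n, z n ≤ ρ ^ n ∨ x n ≤ ρ ^ n ∨ y n ≤ ρ ^ n := fun n => by
    have := hρ n; tauto
  obtain ⟨N₀, hN₀⟩ := eventually_atTop.mp
    ((tendsto_pow_atTop_nhds_zero_of_lt_one hρ0.le hρ1).eventually_lt_const hε)
  -- At any late time the exponentially small coordinate leads to an event of its kind, at once or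
  -- after escape from a vertex. Each of the three kinds occurs only finitely often by
  -- `not_cesaro_of_event`, a contradiction.
  have step : ∀ {a b c : ℝ} {x y z : ℕ → ℝ}, IsCyclicOrbit a b c x y z → 4 * (μ / 4) ≤ b →
      4 * (μ / 4) ≤ c → (∀ n, x n ≤ ρ ^ n ∨ y n ≤ ρ ^ n ∨ z n ≤ ρ ^ n) →
      ∀ n, N₀ ≤ n → x n ≤ ρ ^ n → ∃ m, n ≤ m ∧ x m ≤ ρ ^ m ∧ μ / 4 ≤ y m := by
    intro a b c x y z h hb hc hρ n hn hx
    by_cases hy : μ / 4 ≤ y n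
    · exact ⟨n, le_rfl, hx, hy⟩
    · exact h.exists_event hb hc hN₀ hρ hn (hx.trans_lt (hN₀ n hn)) (not_le.mp hy)
  have hnot : ∀ {s t : ℕ → ℝ}, ¬ (∀ N : ℕ, ∃ m, N ≤ m ∧ s m ≤ ρ ^ m ∧ μ / 4 ≤ t m) →
      ∃ N, ∀ m, N ≤ m → ¬ (s m ≤ ρ ^ m ∧ μ / 4 ≤ t m) := by
    intro s t hst
    push Not at hst
    obtain ⟨N, hN⟩ := hst
    exact ⟨N, fun m hm hm' => absurd (hN m hm hm'.1) (not_lt.mpr hm'.2)⟩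
  obtain ⟨N₁, h₁⟩ := hnot fun hev => h.not_cesaro_of_event hε ha' hc' hρ0 hρ1 hρ hev hp hq
  obtain ⟨N₂, h₂⟩ := hnot fun hev =>
    h.rotate.not_cesaro_of_event hε hc' hb' hρ0 hρ1 hρy hev hq hr
  obtain ⟨N₃, h₃⟩ := hnot fun hev =>
    h.rotate.rotate.not_cesaro_of_event hε hb' ha' hρ0 hρ1 hρz hev hr hp
  rcases hρ (N₀ + N₁ + N₂ + N₃) with hx | hy | hz
  · obtain ⟨m, hm, hm'⟩ := step h hb' hc' hρ _ (by omega) hx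
    exact h₁ m (by omega) hm'
  · obtain ⟨m, hm, hm'⟩ := step h.rotate ha' hb' hρy _ (by omega) hy
    exact h₂ m (by omega) hm'
  · obtain ⟨m, hm, hm'⟩ := step h.rotate.rotate hc' ha' hρz _ (by omega) hz
    exact h₃ m (by omega) hm'

end IsCyclicOrbit

/-! ### Isomorphisms and structure matrices -/

theorem IsNaturalBasis.repr_mul {ι K E : Type*} [Fintype ι] [Field K]
    [NonUnitalNonAssocRing E] [Module K E] [IsScalarTower K E E] [SMulCommClass K E E]
    {b : Module.Basis ι K E} {A : Matrix ι ι K} (h : IsNaturalBasis b A) (u v : E) (l : ι) :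
    b.repr (u * v) l = ∑ k, b.repr u k * b.repr v k * A k l := by
  classical
  have e : u * v = ∑ k, (b.repr u k * b.repr v k) • ∑ l, A k l • b l := by
    conv_lhs => rw [← b.sum_repr u, ← b.sum_repr v]
    rw [Finset.sum_mul]
    refine Finset.sum_congr rfl fun k _ => ?_
    rw [Finset.mul_sum, Finset.sum_eq_single k]
    · rw [smul_mul_assoc, mul_smul_comm, smul_smul, h.mul_self]
    · intro j _ hj
      rw [smul_mul_assoc, mul_smul_comm, h.mul_of_ne k j hj.symm, smul_zero, smul_zero]
    · simp
  rw [e]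
  simp [Finsupp.single_apply]

/-- Two linearly independent rows orthogonal to a third nonzero one, in the sense that the
products of coordinates lie in the left kernel of the structure matrix, have disjoint support. -/
theorem mul_eq_zero_of_rows {K : Type*} [Field K] {a b c : K} (ha : a ≠ 0) (hb : b ≠ 0)
    (hc : c ≠ 0) {p q r : Fin 3 → K}
    (hker : ∀ s ∈ ({(p, q), (p, r)} : Set ((Fin 3 → K) × (Fin 3 → K))),
      b * (s.1 0 * s.2 0) = c * (s.1 1 * s.2 1) ∧ a * (s.1 0 * s.2 0) = c * (s.1 2 * s.2 2))
    (hli : ∀ s t : K, s • q + t • r = 0 → s = 0 ∧ t = 0) (k : Fin 3) : p k * q k = 0 := by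
  obtain ⟨h1, h2⟩ := hker (p, q) (by simp)
  obtain ⟨h3, h4⟩ := hker (p, r) (by simp)
  simp only at h1 h2 h3 h4
  -- The left kernel is the line through `(c, b, a)`. If `p 0 * q 0 ≠ 0` then `p` vanishes nowhere,
  -- and the products of `p` with `q` and `r` lying on one line make `q` and `r` proportional.
  have h0 : p 0 * q 0 = 0 := by
    by_contra hne
    have hp0 : p 0 ≠ 0 := left_ne_zero_of_mul hne
    have hq0 : q 0 ≠ 0 := right_ne_zero_of_mul hne
    have n1 : p 1 * q 1 ≠ 0 := fun h => mul_ne_zero hb hne (by rw [h1, h, mul_zero])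
    have n2 : p 2 * q 2 ≠ 0 := fun h => mul_ne_zero ha hne (by rw [h2, h, mul_zero])
    have hp1 : p 1 ≠ 0 := left_ne_zero_of_mul n1
    have hp2 : p 2 ≠ 0 := left_ne_zero_of_mul n2
    have e1 : r 0 * q 1 = q 0 * r 1 := by
      have : (c * p 1 * (b * p 0)) * (r 0 * q 1 - q 0 * r 1) = 0 := by
        linear_combination (c * p 1 * q 1) * h3 - (c * p 1 * r 1) * h1
      simpa [hc, hb, hp0, hp1, sub_eq_zero] using this
    have e2 : r 0 * q 2 = q 0 * r 2 := by
      have : (c * p 2 * (a * p 0)) * (r 0 * q 2 - q 0 * r 2) = 0 := by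
        linear_combination (c * p 2 * q 2) * h4 - (c * p 2 * r 2) * h2
      simpa [hc, ha, hp0, hp2, sub_eq_zero] using this
    have := hli (r 0) (-q 0) (by
      ext k
      fin_cases k <;> simp <;> [ring; linear_combination e1; linear_combination e2])
    exact hq0 (neg_eq_zero.mp this.2)
  fin_cases k
  · exact h0
  · rw [h0, mul_zero] at h1
    simpa [hc] using h1.symm
  · rw [h0, mul_zero] at h2
    simpa [hc] using h2.symm

/-- An isomorphism of the algebras rescales the rows of the structure matrix after a
permutation of the indices. -/
theorem exists_perm_row_scaling {K E₁ E₂ : Type*} [Field K] [Algebra ℝ K]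
    [NonUnitalNonAssocRing E₁] [Module K E₁]
    [NonUnitalNonAssocRing E₂] [Module K E₂] [IsScalarTower K E₂ E₂] [SMulCommClass K E₂ E₂]
    {A₁ : Matrix (Fin 3) (Fin 3) ℝ} {a b c : ℝ} (ha : a ≠ 0) (hb : b ≠ 0) (hc : c ≠ 0)
    (hA₁ : A₁.transpose = -A₁)
    {e : Module.Basis (Fin 3) K E₁} {f : Module.Basis (Fin 3) K E₂}
    (h₁ : IsNaturalBasis e (A₁.map (algebraMap ℝ K)))
    (h₂ : IsNaturalBasis f ((skewMatrix a b c).map (algebraMap ℝ K)))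
    (hiso : AlgIsomorphic K E₁ E₂) :
    ∃ σ : Equiv.Perm (Fin 3), ∃ r : Fin 3 → ℝ,
      ∀ i k, A₁ i k = r i * skewMatrix a b c (σ i) (σ k) := by
  obtain ⟨ψ, hinj, -⟩ := hiso
  set P : Fin 3 → Fin 3 → K := fun i k => f.repr (ψ (e i)) k with hP
  have hli : LinearIndependent K P := by
    have h1 : LinearIndependent K (fun i => ψ (e i)) :=
      e.linearIndependent.map' (ψ : E₁ →ₗ[K] E₂) (LinearMap.ker_eq_bot.mpr hinj)
    exact h1.map' (f.equivFun : E₂ →ₗ[K] (Fin 3 → K)) f.equivFun.ker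
  have hpair : ∀ i j, i ≠ j → ∀ s t : K, s • P i + t • P j = 0 → s = 0 ∧ t = 0 := by
    intro i j hij
    have := hli.comp ![i, j] (by
      intro x y hxy
      fin_cases x <;> fin_cases y <;> simp_all)
    intro s t hst
    have h2 := Fintype.linearIndependent_iff.mp this ![s, t]
      (by simpa [Fin.sum_univ_two] using hst)
    exact ⟨h2 0, h2 1⟩
  have hm : ∀ {t : ℝ}, t ≠ 0 → algebraMap ℝ K t ≠ 0 := fun ht => by simpa using ht
  have hker : ∀ i j, i ≠ j →
      algebraMap ℝ K b * (P i 0 * P j 0) = algebraMap ℝ K c * (P i 1 * P j 1) ∧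
      algebraMap ℝ K a * (P i 0 * P j 0) = algebraMap ℝ K c * (P i 2 * P j 2) := by
    intro i j hij
    have h0 : ψ (e i) * ψ (e j) = 0 := by rw [← map_mul, h₁.mul_of_ne i j hij, map_zero]
    have hk := fun l => h₂.repr_mul (ψ (e i)) (ψ (e j)) l
    rw [h0] at hk
    have hk1 := hk 1
    have hk2 := hk 2
    simp [Fin.sum_univ_three, skewMatrix] at hk1 hk2
    simp only [hP]
    constructor
    · linear_combination hk2
    · linear_combination -hk1
  have hdis : ∀ i j, i ≠ j → ∀ k, P i k * P j k = 0 := by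
    intro i j hij k
    obtain ⟨l, hl1, hl2⟩ : ∃ l : Fin 3, l ≠ i ∧ l ≠ j := by
      revert hij; revert i j; decide
    refine mul_eq_zero_of_rows (hm ha) (hm hb) (hm hc) (r := P l) ?_ (hpair j l hl2.symm) k
    rintro s (rfl | rfl)
    · exact hker i j hij
    · exact hker i l hl1.symm
  have hex : ∀ i, ∃ k, P i k ≠ 0 := fun i => by
    by_contra hcon
    push Not at hcon
    exact hli.ne_zero i (funext hcon)
  choose τ hτ using hex
  have hτinj : Function.Injective τ := by
    intro i j hij
    by_contra hne
    exact mul_ne_zero (hτ i) (by rw [hij]; exact hτ j) (hdis i j hne (τ i))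
  set σ : Equiv.Perm (Fin 3) := Equiv.ofBijective τ (Finite.injective_iff_bijective.mp hτinj)
    with hσ
  have hoff : ∀ i j, i ≠ j → P i (τ j) = 0 := fun i j hij =>
    (mul_eq_zero.mp (hdis i j hij (τ j))).resolve_right (hτ j)
  have hrow : ∀ i k, algebraMap ℝ K (A₁ i k) * P k (τ k) =
      P i (τ i) ^ 2 * algebraMap ℝ K (skewMatrix a b c (τ i) (τ k)) := by
    intro i k
    have h3 := h₂.repr_mul (ψ (e i)) (ψ (e i)) (τ k)
    rw [← map_mul, h₁.mul_self, map_sum, map_sum, Finsupp.finsetSum_apply,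
      Finset.sum_eq_single k, Finset.sum_eq_single (τ i)] at h3
    · rw [map_smul, map_smul] at h3
      simpa [hP, sq, Algebra.smul_def] using h3
    · intro l _ hl
      obtain ⟨j, rfl⟩ := σ.surjective l
      have : P i (τ j) = 0 := hoff i j (fun h => hl (by rw [h]; rfl))
      simp only [hP] at this
      simp [hσ, this]
    · simp
    · intro j _ hj
      have := hoff j k hj
      simp only [hP] at this
      rw [map_smul, map_smul]
      simp [this]
    · simp
  have hB : ∀ i k, i ≠ k → skewMatrix a b c (τ i) (τ k) ≠ 0 := by
    intro i k hik
    have hne : τ i ≠ τ k := fun h => hik (hτinj h)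
    revert hne
    generalize τ i = u
    generalize τ k = v
    fin_cases u <;> fin_cases v <;> simp [skewMatrix, ha, hb, hc]
  have hBs : ∀ u v, skewMatrix a b c u v = -skewMatrix a b c v u := by
    intro u v
    fin_cases u <;> fin_cases v <;> simp [skewMatrix]
  have hAs : ∀ i k, A₁ k i = -A₁ i k := fun i k => congrFun (congrFun hA₁ i) k
  have hquot : ∀ i k, i ≠ k → algebraMap ℝ K (A₁ i k / skewMatrix a b c (τ i) (τ k)) * P k (τ k) =
      P i (τ i) ^ 2 := by
    intro i k hik
    have hn := hm (hB i k hik)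
    rw [map_div₀, div_mul_eq_mul_div, hrow, mul_div_assoc, div_self hn, mul_one]
  -- Skew-symmetry gives the same quotient `t` for `(i, k)` and `(k, i)`, so `t * v = u ^ 2` and `t
  -- * u = v ^ 2`; hence `u ^ 3 = v ^ 3 = t ^ 3`.
  have hcube : ∀ i k, i ≠ k →
      algebraMap ℝ K ((A₁ i k / skewMatrix a b c (τ i) (τ k)) ^ 3) = P i (τ i) ^ 3 := by
    intro i k hik
    have q1 := hquot i k hik
    have q2 := hquot k i hik.symm
    rw [hAs i k, hBs, neg_div_neg_eq] at q2
    rw [map_pow]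
    set t := algebraMap ℝ K (A₁ i k / skewMatrix a b c (τ i) (τ k))
    set u := P i (τ i)
    set v := P k (τ k)
    have huv : u ^ 3 = v ^ 3 := by linear_combination (-u) * q1 + v * q2
    have hv : v ^ 3 ≠ 0 := pow_ne_zero 3 (hτ k)
    apply mul_right_cancel₀ hv
    rw [← mul_pow, q1]
    rw [← huv]
    ring
  have hex2 : ∀ i : Fin 3, ∃ ri : ℝ, ∀ k, A₁ i k = ri * skewMatrix a b c (τ i) (τ k) := by
    intro i
    obtain ⟨j, hj⟩ : ∃ j : Fin 3, i ≠ j := by revert i; decide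
    refine ⟨A₁ i j / skewMatrix a b c (τ i) (τ j), fun k => ?_⟩
    by_cases hik : i = k
    · subst hik
      have h1 := hAs i i
      have h2 := hBs (τ i) (τ i)
      rw [show A₁ i i = 0 by linarith, show skewMatrix a b c (τ i) (τ i) = 0 by linarith, mul_zero]
    -- The quotients are real, so equal cubes make them equal; in `K` they could differ by a cube
    -- root of unity.
    · have h3 := (hcube i j hj).trans (hcube i k hik).symm
      have h4 := (algebraMap ℝ K).injective h3
      have h5 := (Odd.strictMono_pow (by decide : Odd 3)).injective h4
      rw [h5, div_mul_cancel₀ _ (hB i k hik)]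
  choose r hr using hex2
  exact ⟨σ, r, hr⟩

/-! ### The sign invariant -/

/-- Every row of the matrix has entries of both signs. -/
def HasMixedRows {ι : Type*} (A : Matrix ι ι ℝ) : Prop :=
  ∀ i, (∃ j, 0 < A i j) ∧ ∃ j, A i j < 0

/-- A row factor keeps or exchanges the two signs; it cannot vanish, since the row of `A` has
nonzero entries. -/
theorem HasMixedRows.of_row_scaling {ι : Type*} {A B : Matrix ι ι ℝ} (hA : HasMixedRows A)
    (σ : Equiv.Perm ι) (r : ι → ℝ) (h : ∀ i k, A i k = r i * B (σ i) (σ k)) :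
    HasMixedRows B := by
  intro u
  obtain ⟨i, rfl⟩ := σ.surjective u
  obtain ⟨⟨j, hj⟩, k, hk⟩ := hA i
  rw [h] at hj hk
  rcases le_total 0 (r i) with hr | hr
  · exact ⟨⟨σ j, pos_of_mul_pos_right hj hr⟩, σ k, neg_of_mul_neg_right hk hr⟩
  · refine ⟨⟨σ k, ?_⟩, σ j, ?_⟩
    · by_contra hcon; push Not at hcon; nlinarith [mul_nonneg_of_nonpos_of_nonpos hr hcon]
    · by_contra hcon; push Not at hcon; nlinarith [mul_nonpos_of_nonpos_of_nonneg hr hcon]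

theorem hasMixedRows_skewMatrix {a b c : ℝ} :
    HasMixedRows (skewMatrix a b c) ↔ (0 < a ∧ 0 < b ∧ 0 < c) ∨ (a < 0 ∧ b < 0 ∧ c < 0) := by
  simp [HasMixedRows, Fin.forall_fin_succ, Fin.exists_fin_succ, skewMatrix]
  grind

/-! ### The ergodic case -/

theorem exists_tendsto_of_mono_bdd {s : ℕ → ℝ} (h0 : ∀ n, 0 ≤ s n) (h1 : ∀ n, s n ≤ 1)
    (h : (∀ n, s n ≤ s (n + 1)) ∨ ∀ n, s (n + 1) ≤ s n) : ∃ l, Tendsto s atTop (𝓝 l) := by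
  rcases h with h | h
  · exact ⟨_, tendsto_atTop_ciSup (monotone_nat_of_le_succ h) ⟨1, by rintro _ ⟨n, rfl⟩; exact h1 n⟩⟩
  · exact ⟨_, tendsto_atTop_ciInf (antitone_nat_of_succ_le h) ⟨0, by rintro _ ⟨n, rfl⟩; exact h0 n⟩⟩

/-- Orbits of a Volterra operator on three species, the first of which beats the other two,
converge. -/
theorem exists_tendsto_of_dominant {α β γ : ℝ} (hα : 0 < α) (hβ : 0 < β)
    {x y z : ℕ → ℝ} (x0 : ∀ n, 0 ≤ x n) (y0 : ∀ n, 0 ≤ y n) (z0 : ∀ n, 0 ≤ z n)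
    (hs : ∀ n, x n + y n + z n = 1)
    (hx : ∀ n, x (n + 1) = x n * (1 + (α * y n + β * z n)))
    (hy : ∀ n, y (n + 1) = y n * (1 + (γ * z n - α * x n))) :
    (∃ l, Tendsto x atTop (𝓝 l)) ∧ (∃ l, Tendsto y atTop (𝓝 l)) ∧ ∃ l, Tendsto z atTop (𝓝 l) := by
  have hgrow : ∀ n, 0 ≤ α * y n + β * z n := fun n =>
    add_nonneg (mul_nonneg hα.le (y0 n)) (mul_nonneg hβ.le (z0 n))
  have hmono : ∀ n, x n ≤ x (n + 1) := fun n => by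
    rw [hx]; nlinarith [x0 n, hgrow n, mul_nonneg (x0 n) (hgrow n)]
  obtain ⟨l, hl⟩ := exists_tendsto_of_mono_bdd x0
    (fun n => by linarith [hs n, y0 n, z0 n]) (Or.inl hmono)
  have hxy : (∃ l, Tendsto y atTop (𝓝 l)) → (∃ l, Tendsto x atTop (𝓝 l)) ∧
      (∃ l, Tendsto y atTop (𝓝 l)) ∧ ∃ l, Tendsto z atTop (𝓝 l) := by
    rintro ⟨l', hl'⟩
    refine ⟨⟨l, hl⟩, ⟨l', hl'⟩, 1 - l - l', ?_⟩
    refine ((tendsto_const_nhds.sub hl).sub hl').congr fun n => ?_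
    linarith [hs n]
  apply hxy
  rcases (x0 0).eq_or_lt with hx0 | hx0
  · have hx00 : ∀ n, x n = 0 := by
      intro n
      induction n with
      | zero => exact hx0.symm
      | succ n ih => rw [hx, ih, zero_mul]
    apply exists_tendsto_of_mono_bdd y0 (fun n => by linarith [hs n, x0 n, z0 n])
    rcases le_total 0 γ with hγ | hγ
    · left
      intro n
      rw [hy, hx00]
      nlinarith [mul_nonneg (y0 n) (mul_nonneg hγ (z0 n))]
    · right
      intro n
      rw [hy, hx00]
      nlinarith [mul_nonneg (y0 n) (mul_nonneg (neg_nonneg.mpr hγ) (z0 n))]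
  · have hpos : ∀ n, x 0 ≤ x n := fun n => monotone_nat_of_le_succ hmono (Nat.zero_le n)
    refine ⟨0, ?_⟩
    -- The increments of `x` tend to zero and are at least `x 0 * α * y n`, which forces `y` to
    -- zero.
    have hd : Tendsto (fun n => (x (n + 1) - x n) / (x 0 * α)) atTop (𝓝 0) := by
      simpa using ((hl.comp (tendsto_add_atTop_nat 1)).sub hl).div_const (x 0 * α)
    refine squeeze_zero y0 (fun n => ?_) hd
    rw [le_div_iff₀ (by positivity), hx]
    have h1 : α * y n ≤ α * y n + β * z n := by linarith [mul_nonneg hβ.le (z0 n)]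
    have h2 : x 0 * (α * y n) ≤ x n * (α * y n + β * z n) :=
      mul_le_mul (hpos n) h1 (mul_nonneg hα.le (y0 n)) (x0 n)
    linarith

theorem tendsto_cesaro_of_coordinates {ι : Type*} [Fintype ι] {u : ℕ → ι → ℝ}
    (h : ∀ i, ∃ l, Tendsto (fun n => u n i) atTop (𝓝 l)) :
    ∃ l : ι → ℝ, Tendsto (fun n : ℕ => (1 / (n : ℝ)) • ∑ k ∈ Finset.range n, u k) atTop (𝓝 l) := by
  choose l hl using h
  refine ⟨l, ?_⟩
  simpa only [one_div] using (tendsto_pi_nhds.mpr hl).cesaro_smul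

theorem iterate_mem_stdSimplex {ι : Type*} [Fintype ι] {V : (ι → ℝ) → ι → ℝ}
    (hV : IsVolterraQSO V) {x : ι → ℝ} (hx : x ∈ stdSimplex ℝ ι) (n : ℕ) :
    V^[n] x ∈ stdSimplex ℝ ι := by
  obtain ⟨p, hp, -, hVp⟩ := hV
  induction n with
  | zero => exact hx
  | succ n ih =>
    rw [Function.iterate_succ_apply']
    set w := V^[n] x
    refine ⟨fun k => ?_, ?_⟩
    · rw [hVp w ih]
      exact Finset.sum_nonneg fun i _ => Finset.sum_nonneg fun j _ =>
        mul_nonneg (mul_nonneg (hp.nonneg i j k) (ih.1 i)) (ih.1 j)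
    · simp only [hVp w ih]
      rw [Finset.sum_comm]
      have : ∀ i, ∑ k, ∑ j, p i j k * w i * w j = w i := by
        intro i
        rw [Finset.sum_comm]
        simp only [← Finset.sum_mul, hp.sum_eq_one, one_mul]
        rw [← Finset.mul_sum, ih.2, mul_one]
      simp only [this]
      exact ih.2

theorem volterraOperator_skewMatrix (a b c : ℝ) (x : Fin 3 → ℝ) :
    volterraOperator (skewMatrix a b c) x 0 = x 0 * (1 + a * x 1 - b * x 2) ∧
    volterraOperator (skewMatrix a b c) x 1 = x 1 * (1 + c * x 2 - a * x 0) ∧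
    volterraOperator (skewMatrix a b c) x 2 = x 2 * (1 + b * x 0 - c * x 1) := by
  simp only [volterraOperator, skewMatrix, Fin.sum_univ_three]
  refine ⟨?_, ?_, ?_⟩ <;> simp <;> ring_nf <;> simp

theorem isErgodicOperator_skewMatrix {a b c : ℝ} (ha : a ≠ 0) (hb : b ≠ 0) (hc : c ≠ 0)
    (hbd : |a| ≤ 1 ∧ |b| ≤ 1 ∧ |c| ≤ 1) (hrow : ¬ HasMixedRows (skewMatrix a b c)) :
    IsErgodicOperator (volterraOperator (skewMatrix a b c)) := by
  intro x hx
  set V := volterraOperator (skewMatrix a b c) with hV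
  have hmem := iterate_mem_stdSimplex (isVolterraQSO_skewMatrix a b c hbd) hx
  have hrec := fun n => volterraOperator_skewMatrix a b c (V^[n] x)
  simp only [← hV, ← Function.iterate_succ_apply' V] at hrec
  have hsum : ∀ n, V^[n] x 0 + V^[n] x 1 + V^[n] x 2 = 1 := fun n => by
    rw [← Fin.sum_univ_three]; exact (hmem n).2
  have h0 := fun n => (hmem n).1 0
  have h1 := fun n => (hmem n).1 1
  have h2 := fun n => (hmem n).1 2
  apply tendsto_cesaro_of_coordinates
  -- Signs that are not all equal give a species that beats the other two.
  have hcases : (0 < a ∧ 0 < -b) ∨ (0 < c ∧ 0 < -a) ∨ (0 < b ∧ 0 < -c) := by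
    rw [hasMixedRows_skewMatrix] at hrow
    rcases ha.lt_or_gt with ha | ha <;> rcases hb.lt_or_gt with hb | hb <;>
      rcases hc.lt_or_gt with hc | hc <;> simp_all
  rcases hcases with ⟨p, q⟩ | ⟨p, q⟩ | ⟨p, q⟩
  · obtain ⟨t0, t1, t2⟩ := exists_tendsto_of_dominant (γ := c) p q h0 h1 h2 hsum
      (fun n => by rw [(hrec n).1]; ring) (fun n => by rw [(hrec n).2.1]; ring)
    intro i; fin_cases i <;> assumption
  · obtain ⟨t1, t2, t0⟩ := exists_tendsto_of_dominant (γ := b) p q h1 h2 h0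
      (fun n => by linarith [hsum n])
      (fun n => by rw [(hrec n).2.1]; ring) (fun n => by rw [(hrec n).2.2]; ring)
    intro i; fin_cases i <;> assumption
  · obtain ⟨t2, t0, t1⟩ := exists_tendsto_of_dominant (γ := a) p q h2 h0 h1
      (fun n => by linarith [hsum n])
      (fun n => by rw [(hrec n).2.2]; ring) (fun n => by rw [(hrec n).1]; ring)
    intro i; fin_cases i <;> assumption

/-! ### The non-ergodic case -/

theorem tendsto_cesaro_coordinate {ι : Type*} {u : ℕ → ι → ℝ} {l : ι → ℝ}
    (h : Tendsto (fun n : ℕ => (1 / (n : ℝ)) • ∑ k ∈ Finset.range n, u k) atTop (𝓝 l)) (i : ι) :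
    Tendsto (fun n : ℕ => (1 / (n : ℝ)) * ∑ k ∈ Finset.range n, u k i) atTop (𝓝 (l i)) := by
  simpa using tendsto_pi_nhds.mp h i

theorem iterate_pos {a b c : ℝ} (hbd : |a| ≤ 1 ∧ |b| ≤ 1 ∧ |c| ≤ 1) {x : Fin 3 → ℝ}
    (hx : x ∈ stdSimplex ℝ (Fin 3)) (hpos : ∀ i, 0 < x i) (n : ℕ) :
    ∀ i, 0 < (volterraOperator (skewMatrix a b c))^[n] x i := by
  set V := volterraOperator (skewMatrix a b c) with hV
  have hmem := iterate_mem_stdSimplex (isVolterraQSO_skewMatrix a b c hbd) hx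
  simp only [abs_le] at hbd
  obtain ⟨⟨a1, a2⟩, ⟨b1, b2⟩, c1, c2⟩ := hbd
  induction n with
  | zero => exact hpos
  | succ n ih =>
    obtain ⟨r0, r1, r2⟩ := volterraOperator_skewMatrix a b c (V^[n] x)
    have hsum : V^[n] x 0 + V^[n] x 1 + V^[n] x 2 = 1 := by
      rw [← Fin.sum_univ_three]; exact (hmem n).2
    rw [Function.iterate_succ_apply']
    have p0 := ih 0
    have p1 := ih 1
    have p2 := ih 2
    intro i
    fin_cases i
    · refine (mul_pos p0 ?_).trans_eq r0.symm
      nlinarith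
    · refine (mul_pos p1 ?_).trans_eq r1.symm
      nlinarith
    · refine (mul_pos p2 ?_).trans_eq r2.symm
      nlinarith

theorem exists_start {μ c : ℝ} (hμ : 0 < μ) (hc : μ ≤ c) (hc1 : c ≤ 1) :
    ∃ t : ℝ, 0 < t ∧ t < 1 ∧ c * Real.log t ≤ 3 * Real.log (μ / 8) := by
  have hc0 : 0 < c := hμ.trans_le hc
  have hlog : Real.log (μ / 8) < 0 := Real.log_neg (by positivity) (by linarith)
  refine ⟨Real.exp (3 * Real.log (μ / 8) / c), Real.exp_pos _, Real.exp_lt_one_iff.mpr ?_, ?_⟩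
  · exact div_neg_of_neg_of_pos (by linarith) hc0
  · rw [Real.log_exp, mul_div_cancel₀ _ hc0.ne']

theorem not_isErgodicOperator_skewMatrix {a b c : ℝ}
    (hbd : |a| ≤ 1 ∧ |b| ≤ 1 ∧ |c| ≤ 1) (hrow : HasMixedRows (skewMatrix a b c)) :
    ¬ IsErgodicOperator (volterraOperator (skewMatrix a b c)) := by
  intro herg
  have hbd' := hbd
  simp only [abs_le] at hbd'
  obtain ⟨⟨a1, a2⟩, ⟨b1, b2⟩, c1, c2⟩ := hbd'
  set V := volterraOperator (skewMatrix a b c) with hV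
  have hstd : ∀ u v w : ℝ, 0 < u → 0 < v → 0 < w → u + v + w = 1 →
      ![u, v, w] ∈ stdSimplex ℝ (Fin 3) ∧ ∀ i, 0 < ![u, v, w] i := by
    intro u v w hu hv hw hs
    have hp : ∀ i, 0 < ![u, v, w] i := by
      intro i; fin_cases i <;> simpa
    exact ⟨⟨fun i => (hp i).le, by simpa [Fin.sum_univ_three] using hs⟩, hp⟩
  rcases hasMixedRows_skewMatrix.mp hrow with ⟨ha, hb, hc⟩ | ⟨ha, hb, hc⟩
  · set μ := min a (min b c)
    have hμ : 0 < μ := lt_min ha (lt_min hb hc)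
    have hμa : μ ≤ a := min_le_left _ _
    have hμb : μ ≤ b := (min_le_right _ _).trans (min_le_left _ _)
    have hμc : μ ≤ c := (min_le_right _ _).trans (min_le_right _ _)
    obtain ⟨t, t0, t1, ht⟩ := exists_start hμ hμc c2
    obtain ⟨hx, hpos⟩ := hstd t ((1 - t) / 2) ((1 - t) / 2) t0 (by linarith) (by linarith) (by ring)
    set x := ![t, (1 - t) / 2, (1 - t) / 2]
    have hit := iterate_pos hbd hx hpos
    have hmem := iterate_mem_stdSimplex (isVolterraQSO_skewMatrix a b c hbd) hx
    have hrec := fun n => volterraOperator_skewMatrix a b c (V^[n] x)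
    simp only [← hV, ← Function.iterate_succ_apply' V] at hrec
    obtain ⟨l, hl⟩ := herg x hx
    have horb : IsCyclicOrbit a b c (fun n => V^[n] x 0) (fun n => V^[n] x 1)
        (fun n => V^[n] x 2) :=
      { a_pos := ha, b_pos := hb, c_pos := hc, a_le := a2, b_le := b2, c_le := c2
        x_pos := fun n => hit n 0
        y_pos := fun n => hit n 1
        z_pos := fun n => hit n 2
        sum_eq := fun n => by rw [← Fin.sum_univ_three]; exact (hmem n).2
        x_succ := fun n => (hrec n).1
        y_succ := fun n => (hrec n).2.1
        z_succ := fun n => (hrec n).2.2 }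
    exact horb.not_cesaro hμ hμa hμb hμc ht (tendsto_cesaro_coordinate hl 0)
      (tendsto_cesaro_coordinate hl 1) (tendsto_cesaro_coordinate hl 2)
  · set μ := min (-a) (min (-b) (-c))
    have hμ : 0 < μ := lt_min (by linarith) (lt_min (by linarith) (by linarith))
    have hμa : μ ≤ -a := min_le_left _ _
    have hμb : μ ≤ -b := (min_le_right _ _).trans (min_le_left _ _)
    have hμc : μ ≤ -c := (min_le_right _ _).trans (min_le_right _ _)
    obtain ⟨t, t0, t1, ht⟩ := exists_start hμ hμb (by linarith)
    obtain ⟨hx, hpos⟩ := hstd ((1 - t) / 2) t ((1 - t) / 2) (by linarith) t0 (by linarith) (by ring)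
    set x := ![(1 - t) / 2, t, (1 - t) / 2]
    have hit := iterate_pos hbd hx hpos
    have hmem := iterate_mem_stdSimplex (isVolterraQSO_skewMatrix a b c hbd) hx
    have hrec := fun n => volterraOperator_skewMatrix a b c (V^[n] x)
    simp only [← hV, ← Function.iterate_succ_apply' V] at hrec
    obtain ⟨l, hl⟩ := herg x hx
    -- Exchanging the first two species reverses the cycle and reduces negative parameters to
    -- positive ones.
    have horb : IsCyclicOrbit (-a) (-c) (-b) (fun n => V^[n] x 1) (fun n => V^[n] x 0)
        (fun n => V^[n] x 2) :=
      { a_pos := by linarith, b_pos := by linarith, c_pos := by linarith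
        a_le := by linarith, b_le := by linarith, c_le := by linarith
        x_pos := fun n => hit n 1
        y_pos := fun n => hit n 0
        z_pos := fun n => hit n 2
        sum_eq := fun n => by
          rw [← (hmem n).2, Fin.sum_univ_three]; ring
        x_succ := fun n => by rw [(hrec n).2.1]; ring
        y_succ := fun n => by rw [(hrec n).1]; ring
        z_succ := fun n => by rw [(hrec n).2.2]; ring }
    exact horb.not_cesaro hμ hμa hμc hμb ht (tendsto_cesaro_coordinate hl 1)
      (tendsto_cesaro_coordinate hl 0) (tendsto_cesaro_coordinate hl 2)

/-! ### Ergodicity criterion and its invariance -/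

theorem isErgodicOperator_skewMatrix_iff {a b c : ℝ} (h : a * b * c ≠ 0)
    (hbd : |a| ≤ 1 ∧ |b| ≤ 1 ∧ |c| ≤ 1) :
    IsErgodicOperator (volterraOperator (skewMatrix a b c)) ↔
      ¬ HasMixedRows (skewMatrix a b c) :=
  ⟨fun he hr => not_isErgodicOperator_skewMatrix hbd hr he,
    isErgodicOperator_skewMatrix (left_ne_zero_of_mul (left_ne_zero_of_mul h))
      (right_ne_zero_of_mul (left_ne_zero_of_mul h)) (right_ne_zero_of_mul h) hbd⟩

theorem AlgIsomorphic.symm {K E₁ E₂ : Type*} [Field K] [NonUnitalNonAssocRing E₁] [Module K E₁]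
    [NonUnitalNonAssocRing E₂] [Module K E₂] (h : AlgIsomorphic K E₁ E₂) :
    AlgIsomorphic K E₂ E₁ := by
  obtain ⟨ψ, hψ⟩ := h
  obtain ⟨g, hl, hr⟩ := Function.bijective_iff_has_inverse.mp hψ
  exact ⟨ψ.inverse g hl hr, hr.injective, hl.surjective⟩

theorem mainTheorem5 {K : Type*} [Field K] [Algebra ℝ K]
    {E₁ : Type*} [NonUnitalNonAssocRing E₁] [Module K E₁]
    [IsScalarTower K E₁ E₁] [SMulCommClass K E₁ E₁]
    {E₂ : Type*} [NonUnitalNonAssocRing E₂] [Module K E₂]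
    [IsScalarTower K E₂ E₂] [SMulCommClass K E₂ E₂]
    (a₁ b₁ c₁ a₂ b₂ c₂ : ℝ)
    (h₁ : a₁ * b₁ * c₁ ≠ 0) (h₂ : a₂ * b₂ * c₂ ≠ 0)
    (hbd₁ : |a₁| ≤ 1 ∧ |b₁| ≤ 1 ∧ |c₁| ≤ 1) (hbd₂ : |a₂| ≤ 1 ∧ |b₂| ≤ 1 ∧ |c₂| ≤ 1)
    (e : Module.Basis (Fin 3) K E₁) (f : Module.Basis (Fin 3) K E₂)
    (hE₁ : IsVolterraEvolutionAlgebra e ((skewMatrix a₁ b₁ c₁).map (algebraMap ℝ K)))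
    (hE₂ : IsVolterraEvolutionAlgebra f ((skewMatrix a₂ b₂ c₂).map (algebraMap ℝ K)))
    (hiso : AlgIsomorphic K E₁ E₂) :
    (IsErgodicOperator (volterraOperator (skewMatrix a₁ b₁ c₁)) ∧
        IsErgodicOperator (volterraOperator (skewMatrix a₂ b₂ c₂))) ∨
      (¬ IsErgodicOperator (volterraOperator (skewMatrix a₁ b₁ c₁)) ∧
        ¬ IsErgodicOperator (volterraOperator (skewMatrix a₂ b₂ c₂))) := by
  have hskew : ∀ a b c : ℝ, (skewMatrix a b c).transpose = -skewMatrix a b c := by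
    intro a b c
    ext i j
    fin_cases i <;> fin_cases j <;> simp [skewMatrix]
  have hmixed : HasMixedRows (skewMatrix a₁ b₁ c₁) ↔ HasMixedRows (skewMatrix a₂ b₂ c₂) := by
    constructor
    · intro h
      obtain ⟨σ, r, hr⟩ := exists_perm_row_scaling
        (left_ne_zero_of_mul (left_ne_zero_of_mul h₂))
        (right_ne_zero_of_mul (left_ne_zero_of_mul h₂)) (right_ne_zero_of_mul h₂)
        (hskew a₁ b₁ c₁) hE₁.isNaturalBasis hE₂.isNaturalBasis hiso
      exact h.of_row_scaling σ r hr
    · intro h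
      obtain ⟨σ, r, hr⟩ := exists_perm_row_scaling
        (left_ne_zero_of_mul (left_ne_zero_of_mul h₁))
        (right_ne_zero_of_mul (left_ne_zero_of_mul h₁)) (right_ne_zero_of_mul h₁)
        (hskew a₂ b₂ c₂) hE₂.isNaturalBasis hE₁.isNaturalBasis hiso.symm
      exact h.of_row_scaling σ r hr
  rw [isErgodicOperator_skewMatrix_iff h₁ hbd₁, isErgodicOperator_skewMatrix_iff h₂ hbd₂, hmixed]
  tauto
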